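/- A finite sequence of points in $\mathbb{R}^d$ is in general position if every $k\le d+1$ of its points are affinely independent. The sign of an ordered $(d+1)$-tuple $(p_1,\dots,p_{d+1})$ of points in $\mathbb{R}^d$ is $\operatorname{sgn}\det X$, where the $j$th column of the $(d+1)\times(d+1)$ matrix $X$ is $(1,p_{j,1},\dots,p_{j,d})$. A sequence $(p_1,\dots,p_n)$ in general position in $\mathbb{R}^d$ is order-type homogeneous if all $(d+1)$-tuples $(p_{i_1},\dots,p_{i_{d+1}})$ with $i_1<\cdots<i_{d+1}$ have the same sign. Let $\mathrm{OT}_d(n)$ be the least $N$ such that every sequence of $N$ points in general position in $\mathbb{R}^d$ contains an order-type homogeneous subsequence of length $n$. Let the tower function be given by $\mathrm{twr}_1(x)=x$ and $\mathrm{twr}_{i+1}(x)=2^{\mathrm{twr}_i(x)}$. Theorem. Let $d\ge 2$ be fixed. Then $\mathrm{OT}_d(n)$ exists for every $n$, and $\mathrm{OT}_d(n)\ge \mathrm{twr}_d(\Omega(n))$; that is, there are a constant $c>0$ and an $n_0$, both depending only on $d$, such that $\mathrm{OT}_d(n)\ge \mathrm{twr}_d(cn)$ for all $n\ge n_0$.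 -/

import Mathlib

/-- The tower function: `twr 1 x = x` and `twr (i + 1) x = 2 ^ twr i x` for `i ≥ 1`.
(The value at index `0` is irrelevant.) -/
noncomputable def twr : ℕ → ℝ → ℝ
  | 0, x => x
  | 1, x => x
  | k + 2, x => (2 : ℝ) ^ twr (k + 1) x

/-- A finite sequence of points in `ℝ^d` is in general position if every at most `d + 1` of its
terms are affinely independent. -/
def InGeneralPosition {d N : ℕ} (p : Fin N → (Fin d → ℝ)) : Prop :=
  ∀ s : Finset (Fin N), s.card ≤ d + 1 → AffineIndependent ℝ (fun i : s => p i)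

/-- The sign (orientation) of an ordered `(d + 1)`-tuple of points in `ℝ^d`: the sign of the
determinant of the matrix whose `j`-th column is `(1, p_{j,1}, …, p_{j,d})`. -/
noncomputable def orientationSign {d : ℕ} (p : Fin (d + 1) → (Fin d → ℝ)) : SignType :=
  SignType.sign
    (Matrix.det (Matrix.of fun i j : Fin (d + 1) =>
      (Fin.cons 1 (p j) : Fin (d + 1) → ℝ) i))

/-- A sequence of points in `ℝ^d` is order-type homogeneous if it is in general position and all
its `(d + 1)`-tuples `(p_{i_1}, …, p_{i_{d+1}})`, `i_1 < ⋯ < i_{d+1}`, have the same sign. -/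
def IsOrderTypeHomogeneous {d n : ℕ} (p : Fin n → (Fin d → ℝ)) : Prop :=
  InGeneralPosition p ∧
    ∀ s t : Fin (d + 1) ↪o Fin n, orientationSign (p ∘ s) = orientationSign (p ∘ t)

/-- The set of all `N` such that every sequence of `N` points in general position in `ℝ^d`
contains an order-type homogeneous subsequence of length `n`. -/
def orderTypeRamseySet (d n : ℕ) : Set ℕ :=
  {N | ∀ p : Fin N → (Fin d → ℝ), InGeneralPosition p →
    ∃ s : Fin n ↪o Fin N, IsOrderTypeHomogeneous (p ∘ s)}

/-- The Ramsey function `OT_d(n)`: the least element of `orderTypeRamseySet d n`. -/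
noncomputable def OT (d n : ℕ) : ℕ := sInf (orderTypeRamseySet d n)

/-! Existence is Ramsey's theorem for the colouring of `(d + 1)`-sets by orientation.

For the lower bound, write a point as a vector with leading coordinate `1`. The minors on the first
`k + 1` coordinates, `k ≤ d`, give the orientations of the projections to `ℝ^k`. The construction
avoids long subsequences homogeneous at all these levels at once, a notion suited to induction on
`d`.

Stepping up (`exists_stepUp`) turns `N` vectors `v_b` into `2 ^ N` vectors in one dimension more:
`x` goes to the sum of `t ^ b * v_b` over its binary digits `b`, below a `1`. For large `t`, a
difference is dominated by the highest differing digit, so a minor of level `k + 1` has the sign of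
a level `k` minor of `v` at the digits where consecutive numbers differ, if these are distinct.
Homogeneity at level 2 makes these digits monotone, so `n + 1` homogeneous terms above yield `n`
below (`exists_leadingHomogeneous_of_stepUp`). Each step thus exponentiates the length and lets the
forbidden length grow by only one.

Order-type homogeneity controls the top level only. By a Grassmann–Plücker relation, homogeneity one
level up lets signs change at most once as one point moves. With Ramsey applied to boundedly many
terms, this gives homogeneity at all levels on a constant fraction of the sequence
(`exists_leadingHomogeneous_all`). -/

/-! ### Finite Ramsey theorem. -/

/-- If every large set contains a large set monochromatic for
`k`-subsets, then every large set contains a set of size `j` in which the colour of a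
`(k + 1)`-subset depends on its least element only. -/
theorem exists_endHomogeneous {κ : Type*} {k : ℕ}
    (ih : ∀ m : ℕ, ∃ R : ℕ, ∀ {α : Type} [LinearOrder α] (X : Finset α) (c : Finset α → κ), R ≤ X.card →
      ∃ Y ⊆ X, Y.card = m ∧ ∃ τ, ∀ T ⊆ Y, T.card = k → c T = τ) (j : ℕ) :
    ∃ R : ℕ, ∀ {α : Type} [LinearOrder α] (X : Finset α) (c : Finset α → κ), R ≤ X.card →
      ∃ A ⊆ X, A.card = j ∧ ∀ a ∈ A, ∃ τ, ∀ T ⊆ A, (∀ b ∈ T, a < b) → T.card = k →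
        c (insert a T) = τ := by
  induction j with
  | zero => exact ⟨0, fun {α} _ X c _ => ⟨∅, by simp, by simp, by simp⟩⟩
  | succ j hj =>
    obtain ⟨R, hR⟩ := hj
    obtain ⟨R', hR'⟩ := ih R
    -- The extra element is the minimum `a`; the rest is made monochromatic for `T ↦ c (insert a
    -- T)`.
    refine ⟨R' + 1, fun {α} _ X c hX => ?_⟩
    have hne : X.Nonempty := Finset.card_pos.1 (by omega)
    set a := X.min' hne with ha
    obtain ⟨Y, hYX, hYc, τ, hτ⟩ := hR' (X.erase a) (fun T => c (insert a T))
      (by rw [Finset.card_erase_of_mem (X.min'_mem hne)]; omega)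
    obtain ⟨A, hAY, hAc, hA⟩ := hR Y c hYc.ge
    have hlt : ∀ b ∈ A, a < b := fun b hb => X.min'_lt_of_mem_erase_min' hne (hYX (hAY hb))
    have haA : a ∉ A := fun h => lt_irrefl _ (hlt a h)
    refine ⟨insert a A, ?_, by rw [Finset.card_insert_of_notMem haA, hAc], ?_⟩
    · exact Finset.insert_subset (X.min'_mem hne)
        (hAY.trans (hYX.trans (Finset.erase_subset _ _)))
    · intro b hb
      rcases Finset.mem_insert.1 hb with rfl | hb
      · exact ⟨τ, fun T hT hTa hTc => hτ T (fun x hx => hAY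
          ((Finset.mem_insert.1 (hT hx)).resolve_left (hTa x hx).ne')) hTc⟩
      · obtain ⟨τ', h'⟩ := hA b hb
        exact ⟨τ', fun T hT hTa hTc => h' T (fun x hx => ((Finset.mem_insert.1 (hT hx)).resolve_left
          ((hlt b hb).trans (hTa x hx)).ne')) hTa hTc⟩

/-- The finite Ramsey theorem for colourings of `k`-subsets with finitely many colours. -/
theorem finite_ramsey (κ : Type*) [Fintype κ] [DecidableEq κ] (k : ℕ) :
    ∀ m : ℕ, ∃ R : ℕ, ∀ {α : Type} [LinearOrder α] (X : Finset α) (c : Finset α → κ), R ≤ X.card →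
      ∃ Y ⊆ X, Y.card = m ∧ ∃ τ, ∀ T ⊆ Y, T.card = k → c T = τ := by
  induction k with
  | zero =>
    intro m
    refine ⟨m, fun {α} _ X c hX => ?_⟩
    obtain ⟨Y, hY, hc⟩ := Finset.exists_subset_card_eq hX
    exact ⟨Y, hY, hc, c ∅, fun T _ hT => by rw [Finset.card_eq_zero.1 hT]⟩
  | succ k ih =>
    intro m
    -- Pigeonhole over the colours attached to least elements leaves `m` of them.
    obtain ⟨R, hR⟩ := exists_endHomogeneous ih (Fintype.card κ * m)
    refine ⟨R, fun {α} _ X c hX => ?_⟩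
    obtain ⟨A, hAX, hAc, hA⟩ := hR X c hX
    have : Nonempty κ := ⟨c ∅⟩
    choose! g hg using hA
    have hκ : (Finset.univ : Finset κ).Nonempty := ⟨c ∅, Finset.mem_univ _⟩
    obtain ⟨τ, -, hτ⟩ := Finset.exists_le_card_fiber_of_mul_le_card_of_maps_to
      (s := A) (t := Finset.univ) (f := g) (n := m) (fun _ _ => Finset.mem_univ _) hκ
      (by rw [hAc, Finset.card_univ])
    obtain ⟨Y, hY, hYc⟩ := Finset.exists_subset_card_eq hτ
    refine ⟨Y, hY.trans ((Finset.filter_subset _ _).trans hAX), hYc, τ, fun T hT hTc => ?_⟩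
    have hne : T.Nonempty := Finset.card_pos.1 (by omega)
    have hmem := Finset.mem_filter.1 (hY (hT (T.min'_mem hne)))
    rw [← Finset.insert_erase (T.min'_mem hne), ← hmem.2]
    exact hg _ hmem.1 _ (fun x hx => (Finset.mem_filter.1 (hY (hT (Finset.mem_of_mem_erase hx)))).1)
      (fun b hb => T.min'_lt_of_mem_erase_min' hne hb)
      (by rw [Finset.card_erase_of_mem (T.min'_mem hne), hTc]; rfl)

/-! ### Existence of the Ramsey number. -/

theorem InGeneralPosition.comp {d N n : ℕ} {p : Fin N → (Fin d → ℝ)} (hp : InGeneralPosition p)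
    {s : Fin n → Fin N} (hs : Function.Injective s) : InGeneralPosition (p ∘ s) := by
  intro t ht
  have := hp (t.map ⟨s, hs⟩) (by rwa [Finset.card_map])
  exact this.comp_embedding (⟨fun i : t => ⟨s i, Finset.mem_map_of_mem ⟨s, hs⟩ i.2⟩,
    fun i j hij => Subtype.ext (hs (congrArg Subtype.val hij))⟩ : t ↪ (t.map ⟨s, hs⟩ : Finset _))

theorem orderTypeRamseySet_nonempty (d n : ℕ) : (orderTypeRamseySet d n).Nonempty := by
  obtain ⟨R, hR⟩ := finite_ramsey SignType (d + 1) n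
  refine ⟨R, fun p hp => ?_⟩
  let c : Finset (Fin R) → SignType := fun T =>
    if h : T.card = d + 1 then orientationSign (p ∘ T.orderEmbOfFin h) else 0
  obtain ⟨Y, -, hYc, τ, hτ⟩ := hR Finset.univ c (by simp)
  let s : Fin n ↪o Fin R := Y.orderEmbOfFin hYc
  refine ⟨s, hp.comp s.injective, ?_⟩
  have key : ∀ t : Fin (d + 1) ↪o Fin n, orientationSign ((p ∘ s) ∘ t) = τ := by
    intro t
    have hcard : (Finset.univ.map (t.trans s).toEmbedding).card = d + 1 := by simp
    have h := hτ (Finset.univ.map (t.trans s).toEmbedding) (fun x hx => by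
      obtain ⟨i, -, rfl⟩ := Finset.mem_map.1 hx
      exact Y.orderEmbOfFin_mem hYc (t i)) hcard
    simp only [c, dif_pos hcard] at h
    rw [← h, ← Finset.orderEmbOfFin_unique' hcard (f := t.trans s)
      (fun x => Finset.mem_map_of_mem _ (Finset.mem_univ x))]
    rfl
  exact fun t t' => (key t).trans (key t').symm

/-! ### Leading minors and their Vandermonde normalisation. -/

/-- The determinant of the first `k + 1` coordinates of `k + 1` vectors. -/
noncomputable def leadingDet (k : ℕ) (u : Fin (k + 1) → ℕ → ℝ) : ℝ :=
  Matrix.det (Matrix.of fun i j : Fin (k + 1) => u j i)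

/-- All `(k + 1)`-tuples of distinct terms are linearly independent in their first `k + 1`
coordinates. -/
def LeadingGeneric (k : ℕ) {N : ℕ} (v : Fin N → ℕ → ℝ) : Prop :=
  ∀ s : Fin (k + 1) → Fin N, Function.Injective s → leadingDet k (v ∘ s) ≠ 0

/-- The leading determinants of order `k + 1` of all increasing tuples have a common strict
sign. -/
def LeadingHomogeneous (k : ℕ) {N : ℕ} (v : Fin N → ℕ → ℝ) : Prop :=
  ∃ ε : ℝ, ∀ s : Fin (k + 1) → Fin N, StrictMono s → 0 < ε * leadingDet k (v ∘ s)

theorem LeadingGeneric.comp {k N n : ℕ} {v : Fin N → ℕ → ℝ} (h : LeadingGeneric k v)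
    {s : Fin n → Fin N} (hs : Function.Injective s) : LeadingGeneric k (v ∘ s) :=
  fun t ht => h (s ∘ t) (hs.comp ht)

theorem LeadingHomogeneous.comp {k N n : ℕ} {v : Fin N → ℕ → ℝ} (h : LeadingHomogeneous k v)
    {s : Fin n → Fin N} (hs : StrictMono s) : LeadingHomogeneous k (v ∘ s) := by
  obtain ⟨ε, hε⟩ := h
  exact ⟨ε, fun t ht => hε (s ∘ t) (hs.comp ht)⟩

theorem leadingDet_comp_perm {k : ℕ} (u : Fin (k + 1) → ℕ → ℝ) (π : Equiv.Perm (Fin (k + 1))) :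
    leadingDet k (u ∘ π) = (Equiv.Perm.sign π : ℤ) * leadingDet k u := by
  unfold leadingDet
  rw [← Matrix.det_permute']
  rfl

theorem leadingDet_pow {k : ℕ} (x : Fin (k + 1) → ℝ) :
    leadingDet k (fun j i => x j ^ i) = (Matrix.vandermonde x).det := by
  rw [← Matrix.det_transpose]
  rfl

theorem det_vandermonde_comp_perm {k : ℕ} (x : Fin (k + 1) → ℝ) (π : Equiv.Perm (Fin (k + 1))) :
    (Matrix.vandermonde (x ∘ π)).det = (Equiv.Perm.sign π : ℤ) * (Matrix.vandermonde x).det := by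
  rw [← leadingDet_pow, ← leadingDet_pow]
  exact leadingDet_comp_perm (fun j i => x j ^ i) π

theorem det_vandermonde_pos {k : ℕ} {x : Fin k → ℝ} (hx : StrictMono x) :
    0 < (Matrix.vandermonde x).det := by
  rw [Matrix.det_vandermonde]
  exact Finset.prod_pos fun i _ => Finset.prod_pos fun j hj =>
    sub_pos.2 (hx (Finset.mem_Ioi.1 hj))

theorem det_vandermonde_cons {k : ℕ} (x : ℝ) (A : Fin k → ℝ) :
    (Matrix.vandermonde (Fin.cons x A : Fin (k + 1) → ℝ)).det
      = (∏ i, (A i - x)) * (Matrix.vandermonde A).det := by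
  rw [Matrix.det_vandermonde, Matrix.det_vandermonde, Fin.prod_univ_succ]
  simp [Fin.prod_Ioi_succ]

theorem sign_mul_self_real {k : ℕ} (π : Equiv.Perm (Fin k)) :
    ((Equiv.Perm.sign π : ℤ) : ℝ) * ((Equiv.Perm.sign π : ℤ) : ℝ) = 1 := by
  rcases Int.units_eq_one_or (Equiv.Perm.sign π) with h | h <;> simp [h]

/-- An injective tuple is a permutation of the increasing enumeration of its image. -/
theorem exists_perm_orderEmbOfFin {m N : ℕ} {τ : Fin m → Fin N} (hτ : Function.Injective τ)
    {T : Finset (Fin N)} (hT : Finset.univ.image τ = T) (hc : T.card = m) :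
    ∃ π : Equiv.Perm (Fin m), τ = T.orderEmbOfFin hc ∘ π := by
  have hmem : ∀ i, ∃ j, T.orderEmbOfFin hc j = τ i := fun i => by
    have : τ i ∈ Set.range (T.orderEmbOfFin hc) := by
      rw [Finset.range_orderEmbOfFin, ← hT]
      simp
    exact this
  choose f hf using hmem
  have hfi : Function.Injective f := fun i j h => hτ (by rw [← hf, ← hf, h])
  exact ⟨Equiv.ofBijective f (Finite.injective_iff_bijective.1 hfi), funext fun i => (hf i).symm⟩

/-- Normalisation by the Vandermonde determinant makes leading determinants symmetric. -/
theorem leadingDet_mul_vandermonde {k N : ℕ} (v : Fin N → ℕ → ℝ) {τ : Fin (k + 1) → Fin N}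
    (hτ : Function.Injective τ) {T : Finset (Fin N)} (hT : Finset.univ.image τ = T)
    (hc : T.card = k + 1) :
    ∃ δ : ℝ, 0 < δ ∧ leadingDet k (v ∘ τ) * (Matrix.vandermonde fun i => (τ i : ℝ)).det
      = leadingDet k (v ∘ T.orderEmbOfFin hc) * δ := by
  obtain ⟨π, hπ⟩ := exists_perm_orderEmbOfFin hτ hT hc
  refine ⟨(Matrix.vandermonde fun i => (T.orderEmbOfFin hc i : ℝ)).det,
    det_vandermonde_pos fun i j hij => ?_, ?_⟩
  · exact_mod_cast (T.orderEmbOfFin hc).strictMono hij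
  · have h1 := leadingDet_comp_perm (v ∘ T.orderEmbOfFin hc) π
    have h2 := det_vandermonde_comp_perm (fun i => (T.orderEmbOfFin hc i : ℝ)) π
    have e1 : v ∘ τ = (v ∘ T.orderEmbOfFin hc) ∘ π := by rw [hπ]; rfl
    have e2 : (fun i => (τ i : ℝ)) = (fun i => (T.orderEmbOfFin hc i : ℝ)) ∘ π := by rw [hπ]; rfl
    rw [e1, e2, h1, h2]
    linear_combination (leadingDet k (v ∘ T.orderEmbOfFin hc) *
      (Matrix.vandermonde fun i => (T.orderEmbOfFin hc i : ℝ)).det) * sign_mul_self_real π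

/-- The Vandermonde factor carries the sign of the sorting permutation, so a condition on increasing
tuples extends to all injective ones. -/
theorem LeadingHomogeneous.mul_vandermonde_pos {k N : ℕ} {v : Fin N → ℕ → ℝ} {ε : ℝ}
    (h : ∀ s : Fin (k + 1) → Fin N, StrictMono s → 0 < ε * leadingDet k (v ∘ s))
    {τ : Fin (k + 1) → Fin N} (hτ : Function.Injective τ) :
    0 < ε * (leadingDet k (v ∘ τ) * (Matrix.vandermonde fun i => (τ i : ℝ)).det) := by
  have hc : (Finset.univ.image τ).card = k + 1 := by
    rw [Finset.card_image_of_injective _ hτ, Finset.card_univ, Fintype.card_fin]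
  obtain ⟨δ, hδ, e⟩ := leadingDet_mul_vandermonde v hτ rfl hc
  rw [e, ← mul_assoc]
  exact mul_pos (h _ (Finset.orderEmbOfFin _ hc).strictMono) hδ

/-! ### Plücker relation and sign changes. -/

/-- The three-term Grassmann–Plücker relation between leading determinants of consecutive
orders. -/
theorem leadingDet_three_term {k : ℕ} (A : Fin k → ℕ → ℝ) (x y z : ℕ → ℝ) :
    leadingDet k (Fin.cons x A) * leadingDet (k + 1) (Fin.cons y (Fin.cons z A))
      - leadingDet k (Fin.cons y A) * leadingDet (k + 1) (Fin.cons x (Fin.cons z A))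
      + leadingDet k (Fin.cons z A) * leadingDet (k + 1) (Fin.cons x (Fin.cons y A)) = 0 := by
  let U : Fin (k + 3) → ℕ → ℝ := Fin.cons x (Fin.cons y (Fin.cons z A))
  let h : (ℕ → ℝ) → ℝ := fun u => leadingDet k (Fin.cons u A)
  let M : Matrix (Fin (k + 3)) (Fin (k + 3)) ℝ := Matrix.of fun i j =>
    (Fin.cons (h (U j)) (fun i' : Fin (k + 2) => U j i') : Fin (k + 3) → ℝ) i
  let cof : Fin (k + 1) → ℝ := fun i => (-1) ^ (i : ℕ) *
    ((Matrix.of fun (i : Fin (k + 1)) (j : Fin k) => A j i).submatrix i.succAbove id).det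
  have hlin : ∀ u, h u = ∑ i : Fin (k + 1), cof i * u i := by
    intro u
    simp only [h, leadingDet]
    rw [Matrix.det_succ_column_zero]
    refine Finset.sum_congr rfl fun i _ => ?_
    have : (Matrix.of fun i j : Fin (k + 1) => (Fin.cons u A : Fin (k + 1) → ℕ → ℝ) j i).submatrix
        i.succAbove Fin.succ = (Matrix.of fun (i : Fin (k + 1)) (j : Fin k) => A j i).submatrix
        i.succAbove id := by
      ext a b; simp
    rw [this]
    simp [cof]
    ring
  have hzero : ∀ i, h (A i) = 0 := by
    intro i
    refine Matrix.det_zero_of_column_eq (i := 0) (j := i.succ) (Fin.succ_ne_zero i).symm ?_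
    intro r
    simp
  -- The top row of `M` is a combination of the rows below, since `h` is linear in the first `k + 1`
  -- coordinates; the last row gets weight `0`. Expansion along the top row leaves three terms, as
  -- `h` kills every `A i`.
  have hdet : M.det = 0 := by
    rw [← Matrix.exists_vecMul_eq_zero_iff]
    refine ⟨Fin.cons (-1) (Fin.snoc cof 0), fun h0 => ?_, ?_⟩
    · have := congrFun h0 0
      simp at this
    · ext j
      simp only [Matrix.vecMul, dotProduct, Fin.sum_univ_succ (n := k + 2), Fin.cons_zero,
        Fin.cons_succ, Pi.zero_apply]
      rw [Fin.sum_univ_castSucc]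
      simp [M, hlin (U j)]
  rw [Matrix.det_succ_row_zero, Fin.sum_univ_succ, Fin.sum_univ_succ, Fin.sum_univ_succ] at hdet
  have e0 : (M.submatrix Fin.succ (Fin.succAbove 0)).det
      = leadingDet (k + 1) (Fin.cons y (Fin.cons z A)) := by
    unfold leadingDet; congr 1
  have e1 : (M.submatrix Fin.succ (Fin.succAbove (Fin.succ 0))).det
      = leadingDet (k + 1) (Fin.cons x (Fin.cons z A)) := by
    unfold leadingDet; congr 1
    ext a b
    refine Fin.cases ?_ (fun b => ?_) b <;> simp [M, U]
  have e2 : (M.submatrix Fin.succ (Fin.succAbove (Fin.succ (Fin.succ 0)))).det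
      = leadingDet (k + 1) (Fin.cons x (Fin.cons y A)) := by
    unfold leadingDet; congr 1
    ext a b
    refine Fin.cases ?_ (fun b => Fin.cases ?_ (fun b => ?_) b) b <;>
      simp only [M, U, Matrix.submatrix_apply, Matrix.of_apply, Fin.cons_succ, Fin.cons_zero,
        Fin.succ_succAbove_zero, Fin.succ_succAbove_succ, Fin.succAbove_zero]
  have e3 : ∀ i : Fin k, M 0 i.succ.succ.succ = 0 := fun i => hzero i
  have f0 : M 0 0 = leadingDet k (Fin.cons x A) := rfl
  have f1 : M 0 (Fin.succ 0) = leadingDet k (Fin.cons y A) := rfl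
  have f2 : M 0 (Fin.succ (Fin.succ 0)) = leadingDet k (Fin.cons z A) := rfl
  rw [e0, e1, e2, f0, f1, f2] at hdet
  simp only [e3, mul_zero, zero_mul, Finset.sum_const_zero, add_zero] at hdet
  simp only [Fin.val_succ, Fin.val_zero] at hdet
  linear_combination hdet

/-- The leading determinant of the set `T` of indices, taken in increasing order, is positive. -/
def LeadingPos (k : ℕ) {N : ℕ} (v : Fin N → ℕ → ℝ) (T : Finset (Fin N)) : Prop :=
  ∃ h : T.card = k + 1, 0 < leadingDet k (v ∘ T.orderEmbOfFin h)

/-- With `x` placed in front of `S`, the product of the `s - x` records the sign of sorting it into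
place. -/
theorem leadingPos_iff {k N : ℕ} (v : Fin N → ℕ → ℝ) {x : Fin N} {S : Finset (Fin N)}
    (hS : S.card = k) (hx : x ∉ S) :
    LeadingPos k v (insert x S) ↔ 0 < leadingDet k (Fin.cons (v x) (v ∘ S.orderEmbOfFin hS)) *
      ((∏ i, ((S.orderEmbOfFin hS i : ℝ) - x)) *
        (Matrix.vandermonde fun i => (S.orderEmbOfFin hS i : ℝ)).det) := by
  have hc : (insert x S).card = k + 1 := by rw [Finset.card_insert_of_notMem hx, hS]
  let τ : Fin (k + 1) → Fin N := Fin.cons x (S.orderEmbOfFin hS)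
  have hτ : Function.Injective τ := by
    refine Fin.cons_injective_iff.2 ⟨?_, (S.orderEmbOfFin hS).injective⟩
    rw [Finset.range_orderEmbOfFin]
    exact hx
  have hT : Finset.univ.image τ = insert x S := by
    rw [← Finset.coe_inj, Finset.coe_image, Finset.coe_univ, Set.image_univ, Fin.range_cons,
      Finset.range_orderEmbOfFin, Finset.coe_insert]
  obtain ⟨δ, hδ, e⟩ := leadingDet_mul_vandermonde v hτ hT hc
  have e1 : v ∘ τ = Fin.cons (v x) (v ∘ S.orderEmbOfFin hS) := by
    funext i; refine Fin.cases rfl (fun i => rfl) i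
  have e2 : (fun i => (τ i : ℝ)) = Fin.cons (x : ℝ) (fun i => (S.orderEmbOfFin hS i : ℝ)) := by
    funext i; refine Fin.cases rfl (fun i => rfl) i
  rw [e1, e2, det_vandermonde_cons] at e
  rw [e, mul_pos_iff_of_pos_right hδ]
  exact ⟨fun ⟨_, h⟩ => h, fun h => ⟨hc, h⟩⟩

theorem LeadingHomogeneous.insert_insert_pos {k N : ℕ} {v : Fin N → ℕ → ℝ} {ε : ℝ}
    (h : ∀ s : Fin (k + 2) → Fin N, StrictMono s → 0 < ε * leadingDet (k + 1) (v ∘ s))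
    {y z : Fin N} {S : Finset (Fin N)} (hS : S.card = k) (hy : y ∉ S) (hz : z ∉ S) (hyz : y < z) :
    0 < ε * (leadingDet (k + 1) (Fin.cons (v y) (Fin.cons (v z) (v ∘ S.orderEmbOfFin hS))) *
      ((∏ i, ((S.orderEmbOfFin hS i : ℝ) - y)) * ((∏ i, ((S.orderEmbOfFin hS i : ℝ) - z)) *
        (Matrix.vandermonde fun i => (S.orderEmbOfFin hS i : ℝ)).det))) := by
  let τ : Fin (k + 2) → Fin N := Fin.cons y (Fin.cons z (S.orderEmbOfFin hS) : Fin (k + 1) → Fin N)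
  have hτ : Function.Injective τ := by
    refine Fin.cons_injective_iff.2 ⟨?_, Fin.cons_injective_iff.2
      ⟨?_, (S.orderEmbOfFin hS).injective⟩⟩
    · rw [Fin.range_cons, Finset.range_orderEmbOfFin]
      simpa [hyz.ne] using hy
    · rw [Finset.range_orderEmbOfFin]
      exact hz
  have e1 : v ∘ τ = Fin.cons (v y) (Fin.cons (v z) (v ∘ S.orderEmbOfFin hS)) := by
    funext i; refine Fin.cases rfl (fun i => Fin.cases rfl (fun i => rfl) i) i
  have e2 : (fun i => (τ i : ℝ)) = Fin.cons (y : ℝ) (Fin.cons (z : ℝ)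
      (fun i => (S.orderEmbOfFin hS i : ℝ)) : Fin (k + 1) → ℝ) := by
    funext i; refine Fin.cases rfl (fun i => Fin.cases rfl (fun i => rfl) i) i
  have key := LeadingHomogeneous.mul_vandermonde_pos h hτ
  rw [e1, e2, det_vandermonde_cons, det_vandermonde_cons, Fin.prod_univ_succ] at key
  simp only [Fin.cons_zero, Fin.cons_succ] at key
  have hpos : (0 : ℝ) < z - y := by
    have : ((y : ℕ) : ℝ) < (z : ℕ) := by exact_mod_cast hyz
    linarith
  refine pos_of_mul_pos_left (b := ((z : ℝ) - y)) ?_ hpos.le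
  refine lt_of_lt_of_eq key ?_
  ring

theorem sign_between {a b c p q r : ℝ} (hp : 0 < p) (hq : 0 < q) (hr : 0 < r)
    (h : a * p - b * q + c * r = 0) (hac : 0 < a ↔ 0 < c) (ha : a ≠ 0) (hc : c ≠ 0) :
    0 < b ↔ 0 < a := by
  by_cases h0 : 0 < a
  · have h1 := hac.1 h0
    refine ⟨fun _ => h0, fun _ => ?_⟩
    have : 0 < b * q := by nlinarith [mul_pos h0 hp, mul_pos h1 hr]
    exact pos_of_mul_pos_left this hq.le
  · have h1 : c < 0 := lt_of_le_of_ne (not_lt.1 fun h' => h0 (hac.2 h')) hc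
    have h2 : a < 0 := lt_of_le_of_ne (not_lt.1 h0) ha
    refine ⟨fun hb => absurd (mul_pos hb hq) ?_, fun h' => absurd h' h0⟩
    have := mul_neg_of_neg_of_pos h2 hp
    have := mul_neg_of_neg_of_pos h1 hr
    linarith

/-- If leading determinants of order `k + 2` all have the same sign, then adding a point to a fixed
`k`-set changes the sign of the leading determinant of order `k + 1` at most once. -/
theorem leadingPos_between {k N : ℕ} {v : Fin N → ℕ → ℝ} (hg : LeadingGeneric k v)
    (hv : LeadingHomogeneous (k + 1) v) {S : Finset (Fin N)} (hS : S.card = k) {x y z : Fin N}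
    (hx : x ∉ S) (hy : y ∉ S) (hz : z ∉ S) (hxy : x < y) (hyz : y < z)
    (h : LeadingPos k v (insert x S) ↔ LeadingPos k v (insert z S)) :
    LeadingPos k v (insert y S) ↔ LeadingPos k v (insert x S) := by
  obtain ⟨ε, hε⟩ := hv
  have pxy := LeadingHomogeneous.insert_insert_pos hε hS hx hy hxy
  have pyz := LeadingHomogeneous.insert_insert_pos hε hS hy hz hyz
  have pxz := LeadingHomogeneous.insert_insert_pos hε hS hx hz (hxy.trans hyz)
  have key := leadingDet_three_term (v ∘ S.orderEmbOfFin hS) (v x) (v y) (v z)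
  have hne : ∀ u ∉ S, leadingDet k (Fin.cons (v u) (v ∘ S.orderEmbOfFin hS)) *
      ((∏ i, ((S.orderEmbOfFin hS i : ℝ) - u)) *
        (Matrix.vandermonde fun i => (S.orderEmbOfFin hS i : ℝ)).det) ≠ 0 := by
    intro u hu
    refine mul_ne_zero ?_ (mul_ne_zero ?_ (det_vandermonde_pos fun i j hij => ?_).ne')
    · have := hg (Fin.cons u (S.orderEmbOfFin hS)) (Fin.cons_injective_iff.2
        ⟨by rw [Finset.range_orderEmbOfFin]; exact hu, (S.orderEmbOfFin hS).injective⟩)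
      convert this using 2
      funext i; refine Fin.cases rfl (fun i => rfl) i
    · refine Finset.prod_ne_zero_iff.2 fun i _ => sub_ne_zero.2 fun h' => hu ?_
      have : S.orderEmbOfFin hS i = u := Fin.ext (by exact_mod_cast h')
      exact this ▸ S.orderEmbOfFin_mem hS i
    · exact_mod_cast (S.orderEmbOfFin hS).strictMono hij
  rw [leadingPos_iff v hS hx, leadingPos_iff v hS hz] at h
  rw [leadingPos_iff v hS hx, leadingPos_iff v hS hy]
  refine sign_between pyz pxz pxy ?_ h (hne x hx) (hne z hz)
  -- All three normalised products carry this same factor times a Plücker term.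
  linear_combination ε * (∏ i, ((S.orderEmbOfFin hS i : ℝ) - x)) *
    (∏ i, ((S.orderEmbOfFin hS i : ℝ) - y)) * (∏ i, ((S.orderEmbOfFin hS i : ℝ) - z)) *
    (Matrix.vandermonde fun i => (S.orderEmbOfFin hS i : ℝ)).det ^ 2 * key

/-- If a property of `(k + 1)`-sets changes at most once along each `k`-set, and is constant on a
set `L ∪ U` with `L` below and `U` above `I`, both with more than `k` elements, then it is constant
on `L ∪ U ∪ I`. -/
theorem constant_of_between {α : Type*} [LinearOrder α] {k : ℕ} {f : Finset α → Prop}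
    (hf : ∀ S : Finset α, S.card = k → ∀ x y z, x ∉ S → y ∉ S → z ∉ S → x < y → y < z →
      (f (insert x S) ↔ f (insert z S)) → (f (insert y S) ↔ f (insert x S)))
    {L U : Finset α} {I : Set α} (hL : k < L.card) (hU : k < U.card)
    (hLI : ∀ a ∈ L, ∀ b ∈ I, a < b) (hIU : ∀ a ∈ U, ∀ b ∈ I, b < a) {τ : Prop}
    (hτ : ∀ T ⊆ L ∪ U, T.card = k + 1 → (f T ↔ τ)) :
    ∀ n : ℕ, ∀ T : Finset α, (T \ (L ∪ U)).card = n → (∀ x ∈ T, x ∈ L ∪ U ∨ x ∈ I) →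
      T.card = k + 1 → (f T ↔ τ) := by
  intro n
  induction n with
  | zero =>
    intro T hT _ hTc
    exact hτ T (Finset.sdiff_eq_empty_iff_subset.1 (Finset.card_eq_zero.1 hT)) hTc
  | succ n ih =>
    intro T hT hTI hTc
    obtain ⟨y, hy⟩ : (T \ (L ∪ U)).Nonempty := Finset.card_pos.1 (by omega)
    have hyT := (Finset.mem_sdiff.1 hy).1
    have hyI : y ∈ I := (hTI y hyT).resolve_left (Finset.mem_sdiff.1 hy).2
    have hSc : (T.erase y).card = k := by rw [Finset.card_erase_of_mem hyT, hTc]; rfl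
    -- Replacing `y` by a fresh point of `L` or of `U` reduces the number of points outside `L ∪ U`;
    -- both replacements have value `τ`, and `y` lies between them.
    obtain ⟨x, hxL, hx⟩ := Finset.exists_mem_notMem_of_card_lt_card (hSc.trans_lt hL)
    obtain ⟨z, hzU, hz⟩ := Finset.exists_mem_notMem_of_card_lt_card (hSc.trans_lt hU)
    have step : ∀ u ∈ L ∪ U, u ∉ T.erase y → (f (insert u (T.erase y)) ↔ τ) := by
      intro u hu hu'
      refine ih _ ?_ ?_ ?_
      · rw [Finset.insert_sdiff_of_mem _ hu, Finset.erase_sdiff_comm, Finset.card_erase_of_mem hy,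
          hT]
        rfl
      · intro w hw
        rcases Finset.mem_insert.1 hw with rfl | hw
        · exact Or.inl hu
        · exact hTI w (Finset.mem_of_mem_erase hw)
      · rw [Finset.card_insert_of_notMem hu', hSc]
    have h1 := step x (Finset.mem_union_left _ hxL) hx
    have h2 := step z (Finset.mem_union_right _ hzU) hz
    have := hf _ hSc x y z hx (Finset.notMem_erase y T) hz (hLI x hxL y hyI) (hIU z hzU y hyI)
      (h1.trans h2.symm)
    rw [Finset.insert_erase hyT] at this
    exact this.trans h1

/-! ### Descent from the top level to all levels. -/

/-- Ramsey is applied only to `R` equally spaced terms, with `R` independent of `n`. Of the `2k + 2`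
terms it selects, `k + 1` lie on each side of a gap containing `n` consecutive terms, to which the
common sign spreads by `constant_of_between`. -/
theorem exists_leadingHomogeneous_pred (k : ℕ) :
    ∃ C : ℕ, ∀ (N n : ℕ) (v : Fin N → ℕ → ℝ), C * (n + 1) ≤ N → LeadingGeneric k v →
      LeadingHomogeneous (k + 1) v →
      ∃ s : Fin n → Fin N, StrictMono s ∧ LeadingHomogeneous k (v ∘ s) := by
  classical
  obtain ⟨R, hR⟩ := finite_ramsey Bool (k + 1) (2 * k + 2)
  refine ⟨R, fun N n v hN hg hv => ?_⟩
  have hlt : ∀ (i : Fin R) (j : ℕ), j ≤ n → i * (n + 1) + j < N := fun i j hj => by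
    have : ((i : ℕ) + 1) * (n + 1) ≤ R * (n + 1) := Nat.mul_le_mul_right _ i.2
    linarith [this.trans hN, add_mul (i : ℕ) 1 (n + 1)]
  let g : Fin R → Fin N := fun i => ⟨i * (n + 1) + 0, hlt i 0 (Nat.zero_le _)⟩
  have hgm : StrictMono g := fun i j hij => by
    have : (i : ℕ) * (n + 1) < j * (n + 1) := Nat.mul_lt_mul_of_pos_right hij n.succ_pos
    simp only [g, Fin.lt_def]
    omega
  obtain ⟨Y, -, hYc, τ, hτ⟩ := hR (α := Fin R) Finset.univ
    (fun T => decide (LeadingPos k v (T.image g))) (by simp)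
  let e := Y.orderEmbOfFin hYc
  let a : Fin R := e ⟨k, by omega⟩
  let b : Fin R := e ⟨k + 1, by omega⟩
  have hab : a < b := e.strictMono (by simp [Fin.lt_def])
  let L : Finset (Fin N) := (Finset.univ.filter fun i : Fin (2 * k + 2) => (i : ℕ) < k + 1).image
    (g ∘ e)
  let U : Finset (Fin N) := (Finset.univ.filter fun i : Fin (2 * k + 2) => k + 1 ≤ (i : ℕ)).image
    (g ∘ e)
  have hge : StrictMono (g ∘ e) := hgm.comp e.strictMono
  have hL : k < L.card := by
    rw [Finset.card_image_of_injective _ hge.injective, Fin.card_filter_val_lt]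
    omega
  have hU : k < U.card := by
    rw [Finset.card_image_of_injective _ hge.injective]
    have h1 := Finset.card_filter_add_card_filter_not (s := (Finset.univ : Finset (Fin (2 * k + 2))))
      (fun i => (i : ℕ) < k + 1)
    rw [Fin.card_filter_val_lt, Finset.card_univ, Fintype.card_fin] at h1
    simp only [not_lt] at h1
    omega
  let s : Fin n → Fin N := fun j => ⟨a * (n + 1) + (j + 1), hlt a (j + 1) j.2⟩
  have hs : StrictMono s := fun i j hij => by
    have : (i : ℕ) < j := hij
    simp only [s, Fin.lt_def]
    omega
  have hLI : ∀ x ∈ L, ∀ y ∈ Set.range s, x < y := by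
    rintro x hx _ ⟨j, rfl⟩
    obtain ⟨i, hi, rfl⟩ := Finset.mem_image.1 hx
    have h1 : (g ∘ e) i ≤ g a := hge.monotone (Fin.le_def.2 (by
      have := (Finset.mem_filter.1 hi).2
      simp only
      omega))
    refine h1.trans_lt ?_
    simp only [g, s, Fin.lt_def]
    omega
  have hIU : ∀ x ∈ U, ∀ y ∈ Set.range s, y < x := by
    rintro x hx _ ⟨j, rfl⟩
    obtain ⟨i, hi, rfl⟩ := Finset.mem_image.1 hx
    have h1 : g b ≤ (g ∘ e) i := hge.monotone (Fin.le_def.2 (by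
      have := (Finset.mem_filter.1 hi).2
      simpa using this))
    refine lt_of_lt_of_le ?_ h1
    have : ((a : ℕ) + 1) * (n + 1) ≤ b * (n + 1) := Nat.mul_le_mul_right _ hab
    have hj := j.2
    simp only [g, s, Fin.lt_def]
    linarith [add_mul (a : ℕ) 1 (n + 1)]
  have hmono : ∀ T ⊆ L ∪ U, T.card = k + 1 → (LeadingPos k v T ↔ (τ = true)) := by
    intro T hT hTc
    have hTg : ∀ x ∈ T, ∃ i ∈ Y, g i = x := by
      intro x hx
      rcases Finset.mem_union.1 (hT hx) with h | h <;>
      · obtain ⟨i, -, rfl⟩ := Finset.mem_image.1 h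
        exact ⟨e i, Y.orderEmbOfFin_mem hYc i, rfl⟩
    have himg : (Y.filter fun i => g i ∈ T).image g = T := by
      ext x
      simp only [Finset.mem_image, Finset.mem_filter]
      constructor
      · rintro ⟨i, ⟨-, hi⟩, rfl⟩
        exact hi
      · intro hx
        obtain ⟨i, hi, rfl⟩ := hTg x hx
        exact ⟨i, ⟨hi, hx⟩, rfl⟩
    have := hτ (Y.filter fun i => g i ∈ T) (Finset.filter_subset _ _)
      (by rw [← hTc, ← himg, Finset.card_image_of_injective _ hgm.injective, himg])
    rw [himg] at this
    rw [← this, decide_eq_true_iff]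
  have hall := constant_of_between (f := LeadingPos k v) (fun S hS x y z hx hy hz hxy hyz h =>
    leadingPos_between hg hv hS hx hy hz hxy hyz h) hL hU hLI hIU hmono
  refine ⟨s, hs, if τ = true then 1 else -1, fun t ht => ?_⟩
  have hst := hs.comp ht
  have hTc : (Finset.univ.image (s ∘ t)).card = k + 1 := by
    rw [Finset.card_image_of_injective _ hst.injective, Finset.card_univ, Fintype.card_fin]
  have hT := hall _ (Finset.univ.image (s ∘ t)) rfl (fun x hx => by
    obtain ⟨i, -, rfl⟩ := Finset.mem_image.1 hx
    exact Or.inr ⟨t i, rfl⟩) hTc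
  have hemb : s ∘ t = (Finset.univ.image (s ∘ t)).orderEmbOfFin hTc :=
    Finset.orderEmbOfFin_unique hTc (fun i => Finset.mem_image_of_mem _ (Finset.mem_univ i)) hst
  have hiff : LeadingPos k v (Finset.univ.image (s ∘ t)) ↔ 0 < leadingDet k ((v ∘ s) ∘ t) := by
    have h' : (v ∘ s) ∘ t = v ∘ (Finset.univ.image (s ∘ t)).orderEmbOfFin hTc :=
      congrArg (v ∘ ·) hemb
    rw [h']
    exact ⟨fun ⟨_, h⟩ => h, fun h => ⟨hTc, h⟩⟩
  rw [hiff] at hT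
  split_ifs with hτ'
  · simpa using hT.2 hτ'
  · have : leadingDet k ((v ∘ s) ∘ t) ≠ 0 := hg (s ∘ t) hst.injective
    have := lt_of_le_of_ne (not_lt.1 fun h => hτ' (hT.1 h)) this
    linarith

/-- A sequence which is homogeneous at the top level has a subsequence of proportional length which
is homogeneous at all levels. -/
theorem exists_leadingHomogeneous_all (d : ℕ) :
    ∃ C : ℕ, ∀ (N n : ℕ) (v : Fin N → ℕ → ℝ), C * (n + 1) ≤ N →
      (∀ k ≤ d, LeadingGeneric k v) → LeadingHomogeneous d v →
      ∃ s : Fin n → Fin N, StrictMono s ∧ ∀ k ≤ d, LeadingHomogeneous k (v ∘ s) := by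
  induction d with
  | zero =>
    refine ⟨1, fun N n v hN _ hv => ⟨Fin.castLE (by omega), Fin.strictMono_castLE _, ?_⟩⟩
    intro k hk
    rw [Nat.le_zero.1 hk]
    exact hv.comp (Fin.strictMono_castLE _)
  | succ d ih =>
    obtain ⟨C, hC⟩ := ih
    obtain ⟨C', hC'⟩ := exists_leadingHomogeneous_pred d
    -- One descent to `C * (n + 1)` terms needs `C' * (C * (n + 1) + 1)` terms.
    refine ⟨C' * (C + 1), fun N n v hN hg hv => ?_⟩
    obtain ⟨s, hs, hsv⟩ := hC' N (C * (n + 1)) v (le_trans (by nlinarith [Nat.zero_le (C' * n)]) hN)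
      (hg d (by omega)) hv
    obtain ⟨t, ht, htv⟩ := hC _ n (v ∘ s) le_rfl
      (fun k hk => (hg k (by omega)).comp hs.injective) hsv
    refine ⟨s ∘ t, hs.comp ht, fun k hk => ?_⟩
    rcases Nat.le_succ_iff.1 hk with hk | rfl
    · exact htv k hk
    · exact hv.comp (hs.comp ht)

/-! ### Highest differing binary digit. -/

/-- The binary expansions of `x < y` differ at position `b`, and agree at all higher positions. -/
def IsTopDiff (x y b : ℕ) : Prop :=
  x.testBit b = false ∧ y.testBit b = true ∧ ∀ j, b < j → x.testBit j = y.testBit j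

theorem exists_isTopDiff {x y : ℕ} (h : x < y) : ∃ b, IsTopDiff x y b := by
  obtain ⟨b, hb, hb'⟩ := Nat.exists_most_significant_bit (n := x ^^^ y)
    (fun h' => h.ne (Nat.xor_eq_zero_iff.1 h'))
  have hj : ∀ j, b < j → x.testBit j = y.testBit j := fun j hj => by
    have := hb' j hj
    simpa [Nat.testBit_xor] using this
  rw [Nat.testBit_xor] at hb
  refine ⟨b, ?_⟩
  rcases hx : x.testBit b <;> rcases hy : y.testBit b <;> simp [hx, hy] at hb
  · exact ⟨hx, hy, hj⟩
  · exact absurd (Nat.lt_of_testBit b hy hx fun j h => (hj j h).symm) h.not_gt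

theorem IsTopDiff.unique {x y b c : ℕ} (hb : IsTopDiff x y b) (hc : IsTopDiff x y c) : b = c := by
  rcases lt_trichotomy b c with h | h | h
  · have := hb.2.2 c h
    rw [hc.1, hc.2.1] at this
    simp at this
  · exact h
  · have := hc.2.2 b h
    rw [hb.1, hb.2.1] at this
    simp at this

theorem IsTopDiff.lt_of_lt_two_pow {x y b N : ℕ} (hb : IsTopDiff x y b) (hy : y < 2 ^ N) :
    b < N := by
  by_contra! h
  have := Nat.testBit_lt_two_pow (hy.trans_le (Nat.pow_le_pow_right (by norm_num) h))
  rw [hb.2.1] at this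
  simp at this

theorem IsTopDiff.ne {x y z b c : ℕ} (hb : IsTopDiff x y b) (hc : IsTopDiff y z c) : b ≠ c := by
  rintro rfl
  have := hb.2.1
  rw [hc.1] at this
  simp at this

/-- Together with `IsTopDiff.trans_of_gt`: the larger of two consecutive differing positions is the
one for the outer pair. -/
theorem IsTopDiff.trans_of_lt {x y z b c : ℕ} (hb : IsTopDiff x y b) (hc : IsTopDiff y z c)
    (h : b < c) : IsTopDiff x z c :=
  ⟨(hb.2.2 c h).trans hc.1, hc.2.1, fun j hj => (hb.2.2 j (h.trans hj)).trans (hc.2.2 j hj)⟩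

theorem IsTopDiff.trans_of_gt {x y z b c : ℕ} (hb : IsTopDiff x y b) (hc : IsTopDiff y z c)
    (h : c < b) : IsTopDiff x z b :=
  ⟨hb.1, (hc.2.2 b h).symm.trans hb.2.1, fun j hj => (hb.2.2 j hj).trans (hc.2.2 j (h.trans hj))⟩

/-! ### The step-up construction. -/

/-- The step-up of a sequence of vectors: the number `x` is sent to the sum of the vectors of the
positions of its binary digits, weighted by powers of `t`, below a leading coordinate `1`. -/
noncomputable def stepUp {N : ℕ} (v : Fin N → ℕ → ℝ) (t : ℝ) (x : ℕ) : ℕ → ℝ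
  | 0 => 1
  | j + 1 => ∑ b : Fin N, (if x.testBit b then (1 : ℝ) else 0) * t ^ (b : ℕ) * v b j

open Filter Topology in
-- Digits above `b` cancel, and those below have weights of lower order than `t ^ b`.
theorem tendsto_stepUp_sub_div {N : ℕ} (v : Fin N → ℕ → ℝ) {x y : ℕ} {b : Fin N}
    (h : IsTopDiff x y b) (j : ℕ) :
    Tendsto (fun t : ℝ => (t ^ (b : ℕ))⁻¹ * (stepUp v t y (j + 1) - stepUp v t x (j + 1)))
      atTop (𝓝 (v b j)) := by
  have hlim : v b j = ∑ a : Fin N, if a = b then v a j else 0 := by simp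
  have heq : (fun t : ℝ => (t ^ (b : ℕ))⁻¹ * (stepUp v t y (j + 1) - stepUp v t x (j + 1)))
      = fun t => ∑ a : Fin N, ((if y.testBit a then (1 : ℝ) else 0) -
        (if x.testBit a then (1 : ℝ) else 0)) * (t ^ (a : ℕ) / t ^ (b : ℕ)) * v a j := by
    funext t
    simp only [stepUp, ← Finset.sum_sub_distrib, Finset.mul_sum]
    refine Finset.sum_congr rfl fun a _ => ?_
    ring
  rw [heq, hlim]
  refine tendsto_finsetSum _ fun a _ => ?_
  rcases lt_trichotomy (a : ℕ) b with hab | hab | hab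
  · rw [if_neg (fun e => hab.ne (congrArg Fin.val e))]
    simpa using ((tendsto_pow_div_pow_atTop_zero hab).const_mul _).mul_const (v a j)
  · have hab' : a = b := Fin.ext hab
    subst hab'
    rw [if_pos rfl]
    refine tendsto_const_nhds.congr' ?_
    filter_upwards [eventually_gt_atTop 0] with t ht
    rw [h.1, h.2.1, div_self (pow_pos ht _).ne']
    simp
  · rw [if_neg (fun e => hab.ne' (congrArg Fin.val e)), h.2.2 a hab]
    simp

/-- Subtracting from each column its predecessor turns the top row into `(1, 0, …, 0)`. -/
theorem leadingDet_succ_eq_sub {k : ℕ} (u : Fin (k + 2) → ℕ → ℝ) (hu : ∀ j, u j 0 = 1) :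
    leadingDet (k + 1) u
      = leadingDet k (fun j i => u j.succ (i + 1) - u j.castSucc (i + 1)) := by
  let B : Matrix (Fin (k + 2)) (Fin (k + 2)) ℝ := Matrix.of fun i j =>
    (Fin.cons (u 0 i) (fun j' : Fin (k + 1) => u j'.succ i - u j'.castSucc i) :
      Fin (k + 2) → ℝ) j
  have hB : leadingDet (k + 1) u = B.det :=
    Matrix.det_eq_of_forall_col_eq_smul_add_pred (fun _ => 1) (fun i => by simp [B])
      (fun i j => by simp [B])
  rw [hB, Matrix.det_succ_row_zero, Fin.sum_univ_succ]
  have h0 : ∀ j : Fin (k + 1), B 0 j.succ = 0 := fun j => by simp [B, hu]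
  have h1 : B 0 0 = 1 := by simp [B, hu]
  simp only [h0, h1]
  simp only [mul_zero, zero_mul, Finset.sum_const_zero, add_zero, Fin.val_zero, pow_zero, one_mul]
  rfl

open Filter Topology in
theorem tendsto_leadingDet {ι : Type*} {l : Filter ι} {k : ℕ} {f : ι → Fin (k + 1) → ℕ → ℝ}
    {u : Fin (k + 1) → ℕ → ℝ} (h : ∀ j i, Tendsto (fun t => f t j i) l (𝓝 (u j i))) :
    Tendsto (fun t => leadingDet k (f t)) l (𝓝 (leadingDet k u)) := by
  have hc : Continuous fun M : Matrix (Fin (k + 1)) (Fin (k + 1)) ℝ => M.det :=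
    continuous_id.matrix_det
  refine (hc.tendsto _).comp (tendsto_pi_nhds.2 fun i => tendsto_pi_nhds.2 fun j => ?_)
  exact h j i

theorem leadingDet_mul {k : ℕ} (c : Fin (k + 1) → ℝ) (u : Fin (k + 1) → ℕ → ℝ) :
    leadingDet k (fun j i => c j * u j i) = (∏ j, c j) * leadingDet k u :=
  Matrix.det_mul_row c _

open Filter Topology in
theorem eventually_stepUp_sign {N k : ℕ} (v : Fin N → ℕ → ℝ) {x : Fin (k + 2) → ℕ}
    {b : Fin (k + 1) → Fin N} (h : ∀ j, IsTopDiff (x j.castSucc) (x j.succ) (b j))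
    (hb : leadingDet k (v ∘ b) ≠ 0) :
    ∀ᶠ t in atTop, 0 < leadingDet (k + 1) (fun j => stepUp v t (x j)) * leadingDet k (v ∘ b) := by
  have hlim := tendsto_leadingDet (l := atTop) (f := fun (t : ℝ) j i => (t ^ (b j : ℕ))⁻¹ *
    (stepUp v t (x j.succ) (i + 1) - stepUp v t (x j.castSucc) (i + 1))) (u := v ∘ b)
    (fun j i => tendsto_stepUp_sub_div v (h j) i)
  have hpos := (hlim.mul_const (leadingDet k (v ∘ b))).eventually_const_lt
    (mul_self_pos.2 hb)
  filter_upwards [hpos, eventually_gt_atTop 0] with t ht ht0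
  rw [leadingDet_mul (fun j => (t ^ (b j : ℕ))⁻¹), mul_assoc] at ht
  rw [leadingDet_succ_eq_sub _ (fun j => rfl)]
  exact pos_of_mul_pos_right ht (Finset.prod_nonneg fun j _ => by positivity)

theorem leadingDet_pow_ne_zero {k N : ℕ} {s : Fin (k + 1) → Fin N} (hs : Function.Injective s) :
    leadingDet k (fun j i => (s j : ℝ) ^ i) ≠ 0 := by
  rw [leadingDet_pow]
  refine Matrix.det_vandermonde_ne_zero_iff.2 fun i j hij => hs (Fin.ext ?_)
  exact_mod_cast hij

open Filter Topology in
-- As a polynomial in `η`, the determinant has a nonzero Vandermonde determinant as its coefficient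
-- of degree `k + 1`, hence finitely many roots.
theorem eventually_leadingDet_perturb_ne_zero {k N : ℕ} (w : Fin N → ℕ → ℝ)
    {s : Fin (k + 1) → Fin N} (hs : Function.Injective s) :
    ∀ᶠ η in 𝓝[>] (0 : ℝ), leadingDet k (fun j i => w (s j) i + η * (s j : ℝ) ^ i) ≠ 0 := by
  let A : Matrix (Fin (k + 1)) (Fin (k + 1)) ℝ := Matrix.of fun i j => (s j : ℝ) ^ (i : ℕ)
  let B : Matrix (Fin (k + 1)) (Fin (k + 1)) ℝ := Matrix.of fun i j => w (s j) i
  let P : Polynomial ℝ := Matrix.det ((Polynomial.X : Polynomial ℝ) • A.map Polynomial.C +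
    B.map Polynomial.C)
  have hP : P ≠ 0 := by
    intro h
    have h1 := Polynomial.coeff_det_X_add_C_card A B
    rw [show Matrix.det ((Polynomial.X : Polynomial ℝ) • A.map Polynomial.C +
      B.map Polynomial.C) = 0 from h, Polynomial.coeff_zero] at h1
    exact leadingDet_pow_ne_zero hs h1.symm
  have heval : ∀ η : ℝ, P.eval η = leadingDet k (fun j i => w (s j) i + η * (s j : ℝ) ^ i) := by
    intro η
    simp only [P, leadingDet]
    rw [← Polynomial.coe_evalRingHom, RingHom.map_det]
    congr 1
    ext i j
    simp [A, B]
    ring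
  have hfin : {η : ℝ | P.eval η = 0}.Finite := by
    refine (P.roots.toFinset.finite_toSet).subset fun η hη => ?_
    simpa [hP] using hη
  have h1 : ∀ᶠ η in 𝓝[≠] (0 : ℝ), η ∉ {η : ℝ | P.eval η = 0} :=
    (nhdsNE_le_cofinite 0) hfin.eventually_cofinite_notMem
  filter_upwards [nhdsGT_le_nhdsNE 0 h1] with η hη
  rw [← heval]
  exact hη

open Filter Topology in
/-- A sequence of vectors with first coordinate `1` may be perturbed to be generic at all levels up
to `d`, keeping the signs of all non-zero leading determinants. -/
theorem exists_generic_perturbation {N : ℕ} (w : Fin N → ℕ → ℝ) (hw : ∀ x, w x 0 = 1) (d : ℕ) :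
    ∃ w' : Fin N → ℕ → ℝ, (∀ x, w' x 0 = 1) ∧ (∀ k ≤ d, LeadingGeneric k w') ∧
      ∀ k ≤ d, ∀ s : Fin (k + 1) → Fin N, leadingDet k (w ∘ s) ≠ 0 →
        0 < leadingDet k (w' ∘ s) * leadingDet k (w ∘ s) := by
  have h1 : ∀ᶠ η in 𝓝[>] (0 : ℝ), ∀ k : Fin (d + 1), ∀ s : Fin ((k : ℕ) + 1) → Fin N,
      Function.Injective s →
        leadingDet k (fun j i => w (s j) i + η * (s j : ℝ) ^ i) ≠ 0 := by
    refine eventually_all.2 fun k => eventually_all.2 fun s => ?_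
    by_cases hs : Function.Injective s
    · filter_upwards [eventually_leadingDet_perturb_ne_zero w hs] with η hη _ using hη
    · exact Eventually.of_forall fun η h => absurd h hs
  have h2 : ∀ᶠ η in 𝓝[>] (0 : ℝ), ∀ k : Fin (d + 1), ∀ s : Fin ((k : ℕ) + 1) → Fin N,
      leadingDet k (w ∘ s) ≠ 0 →
        0 < leadingDet k (fun j i => w (s j) i + η * (s j : ℝ) ^ i) * leadingDet k (w ∘ s) := by
    refine eventually_all.2 fun k => eventually_all.2 fun s => ?_
    by_cases hs : leadingDet k (w ∘ s) = 0
    · exact Eventually.of_forall fun η h => absurd hs h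
    · have hlim := tendsto_leadingDet (l := 𝓝[>] (0 : ℝ))
        (f := fun η j i => w (s j) i + η * (s j : ℝ) ^ i) (u := w ∘ s) (fun j i => by
          have : Continuous fun η : ℝ => w (s j) i + η * (s j : ℝ) ^ i := by fun_prop
          simpa using (this.tendsto 0).mono_left nhdsWithin_le_nhds)
      filter_upwards [(hlim.mul_const (leadingDet k (w ∘ s))).eventually_const_lt
        (mul_self_pos.2 hs)] with η hη _ using hη
  obtain ⟨η, ⟨hη1, hη2⟩, hη⟩ := ((h1.and h2).and self_mem_nhdsWithin).exists
  have hη : 0 < η := hη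
  -- This factor restores the leading coordinate, which the perturbation moves to `1 + η`.
  have hc : 0 < (1 + η)⁻¹ := by positivity
  have hdet : ∀ (k : ℕ) (s : Fin (k + 1) → Fin N),
      leadingDet k ((fun x i => (1 + η)⁻¹ * (w x i + η * (x : ℝ) ^ i)) ∘ s)
        = (∏ _j : Fin (k + 1), (1 + η)⁻¹) *
          leadingDet k (fun j i => w (s j) i + η * (s j : ℝ) ^ i) :=
    fun k s => leadingDet_mul (fun _ => (1 + η)⁻¹) (fun j i => w (s j) i + η * (s j : ℝ) ^ i)
  have hprod : ∀ k : ℕ, 0 < ∏ _j : Fin (k + 1), (1 + η)⁻¹ := fun k => Finset.prod_pos fun _ _ => hc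
  refine ⟨fun x i => (1 + η)⁻¹ * (w x i + η * (x : ℝ) ^ i), fun x => ?_, fun k hk s hs => ?_,
    fun k hk s hs => ?_⟩
  · simp only
    rw [hw, pow_zero, mul_one, inv_mul_cancel₀ (by positivity)]
  · rw [hdet]
    exact mul_ne_zero (hprod k).ne' (hη1 ⟨k, by omega⟩ s hs)
  · rw [hdet, mul_assoc]
    exact mul_pos (hprod k) (hη2 ⟨k, by omega⟩ s hs)

open Filter Topology in
-- One large `t` serves the finitely many tuples. The limit says nothing about tuples with repeated
-- digits, so a perturbation supplies genericity and keeps the signs already fixed.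
theorem exists_stepUp {N d : ℕ} (v : Fin N → ℕ → ℝ) (hg : ∀ k ≤ d, LeadingGeneric k v) :
    ∃ w : Fin (2 ^ N) → ℕ → ℝ, (∀ x, w x 0 = 1) ∧ (∀ k ≤ d + 1, LeadingGeneric k w) ∧
      ∀ k ≤ d, ∀ (x : Fin (k + 2) → Fin (2 ^ N)) (b : Fin (k + 1) → Fin N), Function.Injective b →
        (∀ j, IsTopDiff (x j.castSucc) (x j.succ) (b j)) →
        0 < leadingDet (k + 1) (w ∘ x) * leadingDet k (v ∘ b) := by
  have h : ∀ᶠ t in (atTop : Filter ℝ), ∀ k : Fin (d + 1), ∀ (x : Fin ((k : ℕ) + 2) → Fin (2 ^ N))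
      (b : Fin ((k : ℕ) + 1) → Fin N), Function.Injective b →
        (∀ j, IsTopDiff (x j.castSucc) (x j.succ) (b j)) →
        0 < leadingDet (k + 1) (fun j => stepUp v t (x j)) * leadingDet k (v ∘ b) := by
    refine eventually_all.2 fun k => eventually_all.2 fun x => eventually_all.2 fun b => ?_
    by_cases hb : Function.Injective b
    · by_cases hx : ∀ j, IsTopDiff (x j.castSucc) (x j.succ) (b j)
      · filter_upwards [eventually_stepUp_sign (x := fun j => x j) v hx
          (hg k (Nat.lt_succ_iff.1 k.2) b hb)] with t ht _ _ using ht
      · exact Eventually.of_forall fun t _ h => absurd h hx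
    · exact Eventually.of_forall fun t h => absurd h hb
  obtain ⟨t, ht⟩ := h.exists
  obtain ⟨w, hw0, hwg, hw⟩ := exists_generic_perturbation
    (fun x : Fin (2 ^ N) => stepUp v t x) (fun _ => rfl) (d + 1)
  refine ⟨w, hw0, hwg, fun k hk x b hb hx => ?_⟩
  have h1 := ht ⟨k, by omega⟩ x b hb hx
  have h2 := hw (k + 1) (by omega) x (left_ne_zero_of_mul h1.ne')
  have h3 := mul_pos h1 h2
  refine pos_of_mul_pos_right (a := leadingDet (k + 1) (fun j => stepUp v t (x j)) ^ 2) ?_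
    (sq_nonneg _)
  refine lt_of_lt_of_eq h3 ?_
  have : leadingDet (k + 1) ((fun x : Fin (2 ^ N) => stepUp v t x) ∘ x)
    = leadingDet (k + 1) (fun j => stepUp v t (x j)) := rfl
  rw [this]
  simp only
  ring

/-! ### Reading a homogeneous subsequence back through the step-up. -/

theorem leadingDet_zero (u : Fin 1 → ℕ → ℝ) : leadingDet 0 u = u 0 0 := by
  simp [leadingDet]

theorem leadingDet_one (u : Fin 2 → ℕ → ℝ) (hu : ∀ j, u j 0 = 1) :
    leadingDet 1 u = u 1 1 - u 0 1 := by
  simp [leadingDet, Matrix.det_fin_two, hu]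

theorem pos_of_pos_mul_of_pos_mul {a b c : ℝ} (h1 : 0 < a * b) (h2 : 0 < b * c) : 0 < a * c := by
  have h3 := mul_pos h1 h2
  refine pos_of_mul_pos_right (a := b ^ 2) ?_ (sq_nonneg b)
  linarith [show a * b * (b * c) = b ^ 2 * (a * c) by ring]

/-- A long subsequence of the step-up which is homogeneous at all levels yields a subsequence of the
original sequence which is one term shorter and homogeneous at all levels. -/
theorem exists_leadingHomogeneous_of_stepUp {N M d n : ℕ} {v : Fin N → ℕ → ℝ} {w : Fin M → ℕ → ℝ}
    (hd : 1 ≤ d) (hM : M ≤ 2 ^ N) (hv0 : ∀ i, v i 0 = 1) (hv1 : ∀ a b, a < b → v a 1 < v b 1)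
    (hw : ∀ k ≤ d, ∀ (x : Fin (k + 2) → Fin M) (b : Fin (k + 1) → Fin N), Function.Injective b →
        (∀ j, IsTopDiff (x j.castSucc) (x j.succ) (b j)) →
        0 < leadingDet (k + 1) (w ∘ x) * leadingDet k (v ∘ b))
    {s : Fin (n + 1) → Fin M} (hs : StrictMono s)
    (hhom : ∀ k ≤ d + 1, LeadingHomogeneous k (w ∘ s)) :
    ∃ u : Fin n → Fin N, StrictMono u ∧ ∀ k ≤ d, LeadingHomogeneous k (v ∘ u) := by
  have hex : ∀ a b : Fin (n + 1), ∃ D : ℕ, a < b → IsTopDiff (s a) (s b) D := fun a b => by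
    by_cases h : a < b
    · obtain ⟨D, hD⟩ := exists_isTopDiff (hs h)
      exact ⟨D, fun _ => hD⟩
    · exact ⟨0, fun h' => absurd h' h⟩
  choose D hD using hex
  have hDN : ∀ a b, a < b → D a b < N := fun a b h =>
    (hD a b h).lt_of_lt_two_pow ((s b).2.trans_le hM)
  have hmono : ∀ a b : Fin N, 0 < v b 1 - v a 1 → a < b := by
    intro a b h
    by_contra! h'
    rcases h'.lt_or_eq with h' | rfl
    · linarith [hv1 b a h']
    · simp at h
  obtain ⟨ε, hε⟩ := hhom 2 (by omega)
  -- Level 2 above corresponds to level 1 below, a difference of first coordinates; as these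
  -- increase, the sign of `ε` orders `D a b` against `D b c`.
  have htriple : ∀ a b c, (hab : a < b) → (hbc : b < c) →
      0 < ε * (v ⟨D b c, hDN b c hbc⟩ 1 - v ⟨D a b, hDN a b hab⟩ 1) := by
    intro a b c hab hbc
    have h1 := hε ![a, b, c] (by
      refine Fin.strictMono_iff_lt_succ.2 fun i => ?_
      fin_cases i <;> simp [hab, hbc])
    have h2 := hw 1 hd (s ∘ ![a, b, c]) ![⟨D a b, hDN a b hab⟩, ⟨D b c, hDN b c hbc⟩] (by
        intro i j hij
        have := (hD a b hab).ne (hD b c hbc)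
        fin_cases i <;> fin_cases j <;> simp_all) (by
        intro i
        fin_cases i
        · exact hD a b hab
        · exact hD b c hbc)
    have h3 := pos_of_pos_mul_of_pos_mul h1 h2
    rwa [leadingDet_one (v ∘ _) (fun j => hv0 _)] at h3
  rcases lt_or_ge 0 ε with hpos | hneg
  · have hinc : ∀ a b c, a < b → b < c → D a b < D b c := fun a b c hab hbc =>
      hmono ⟨D a b, hDN a b hab⟩ ⟨D b c, hDN b c hbc⟩
        (pos_of_mul_pos_right (htriple a b c hab hbc) hpos.le)
    have hD0 : ∀ a b, a < b → D a b = D 0 b := by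
      intro a b hab
      rcases eq_or_ne a 0 with rfl | ha
      · rfl
      · have h0 := Fin.pos_of_ne_zero ha
        exact ((hD 0 a h0).trans_of_lt (hD a b hab) (hinc 0 a b h0 hab)).unique
          (hD 0 b (h0.trans hab))
    let u : Fin n → Fin N := fun i => ⟨D 0 i.succ, hDN 0 i.succ i.succ_pos⟩
    have hu : StrictMono u := fun i j hij => by
      have h := hinc 0 i.succ j.succ i.succ_pos (Fin.succ_lt_succ_iff.2 hij)
      rw [hD0 _ _ (Fin.succ_lt_succ_iff.2 hij)] at h
      exact h
    refine ⟨u, hu, fun k hk => ?_⟩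
    obtain ⟨ε', hε'⟩ := hhom (k + 1) (by omega)
    refine ⟨ε', fun t ht => ?_⟩
    -- Since `D a b = D 0 b`, the successive differing digits along `X` are exactly `u ∘ t`.
    let X : Fin (k + 2) → Fin (n + 1) := Fin.cons 0 (Fin.succ ∘ t)
    have hX : StrictMono X := by
      refine Fin.strictMono_iff_lt_succ.2 fun i => Fin.cases ?_ (fun i => ?_) i
      · simp [X]
      · simp only [X, Fin.castSucc_succ, Fin.cons_succ, Function.comp_apply, Fin.succ_lt_succ_iff]
        exact ht Fin.castSucc_lt_succ
    refine pos_of_pos_mul_of_pos_mul (hε' X hX)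
      (hw k hk (s ∘ X) (u ∘ t) (hu.comp ht).injective fun j => ?_)
    have h1 : X j.castSucc < X j.succ := hX Fin.castSucc_lt_succ
    have h2 := hD _ _ h1
    rw [hD0 _ _ h1] at h2
    exact h2
  · have hneg' : ∀ {x : ℝ}, 0 < ε * x → 0 < -x := fun {x} h => by
      by_contra! h'
      nlinarith [mul_nonneg (neg_nonneg.2 hneg) (neg_nonpos.1 h')]
    have hdec : ∀ a b c, a < b → b < c → D b c < D a b := fun a b c hab hbc =>
      hmono ⟨D b c, hDN b c hbc⟩ ⟨D a b, hDN a b hab⟩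
        (by linarith [hneg' (htriple a b c hab hbc)])
    have hDl : ∀ a b, a < b → D a b = D a (Fin.last n) := by
      intro a b hab
      rcases eq_or_ne b (Fin.last n) with rfl | hb
      · rfl
      · have h0 := Fin.lt_last_iff_ne_last.2 hb
        exact ((hD a b hab).trans_of_gt (hD b _ h0) (hdec a b _ hab h0)).unique
          (hD a _ (hab.trans h0))
    let g : Fin n → Fin N := fun i => ⟨D i.castSucc (Fin.last n), hDN _ _ i.castSucc_lt_last⟩
    have hg : StrictAnti g := fun i j hij => by
      have h := hdec i.castSucc j.castSucc _ (Fin.castSucc_lt_castSucc_iff.2 hij) j.castSucc_lt_last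
      rw [hDl _ _ (Fin.castSucc_lt_castSucc_iff.2 hij)] at h
      exact h
    have hu : StrictMono (g ∘ Fin.rev) := hg.comp Fin.rev_strictAnti
    refine ⟨g ∘ Fin.rev, hu, fun k hk => ?_⟩
    obtain ⟨ε', hε'⟩ := hhom (k + 1) (by omega)
    -- The digits now decrease along the sequence, so sorting them costs the sign of the reversal.
    refine ⟨ε' * ((Equiv.Perm.sign (Fin.revPerm : Equiv.Perm (Fin (k + 1))) : ℤ) : ℝ),
      fun t ht => ?_⟩
    let X : Fin (k + 2) → Fin (n + 1) :=
      Fin.snoc (α := fun _ => Fin (n + 1)) (Fin.castSucc ∘ Fin.rev ∘ t ∘ Fin.rev) (Fin.last n)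
    have hX : StrictMono X := by
      refine Fin.strictMono_iff_lt_succ.2 fun i => Fin.lastCases ?_ (fun i => ?_) i
      · simp [X]
      · rw [← Fin.castSucc_succ]
        simp only [X, Fin.snoc_castSucc, Function.comp_apply, Fin.castSucc_lt_castSucc_iff,
          Fin.rev_lt_rev]
        exact ht (Fin.rev_lt_rev.2 Fin.castSucc_lt_succ)
    have key := pos_of_pos_mul_of_pos_mul (hε' X hX)
      (hw k hk (s ∘ X) (((g ∘ Fin.rev) ∘ t) ∘ Fin.rev)
        (((hu.comp ht).injective).comp Fin.rev_injective) fun j => by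
        have h1 : X j.castSucc < X j.succ := hX Fin.castSucc_lt_succ
        have h2 := hD _ _ h1
        rw [hDl _ _ h1] at h2
        have h3 : X j.castSucc = (Fin.rev (t (Fin.rev j))).castSucc := by
          simp [X, Fin.snoc_castSucc]
        have h4 : (((((g ∘ Fin.rev) ∘ t) ∘ Fin.rev) j : Fin N) : ℕ)
          = D (X j.castSucc) (Fin.last n) := by
          rw [h3]
          rfl
        rw [h4]
        exact h2)
    have hperm := leadingDet_comp_perm (v ∘ (g ∘ Fin.rev) ∘ t) Fin.revPerm
    rw [mul_assoc, Function.comp_assoc, ← hperm]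
    exact key

/-- For every `d ≥ 1` there are generic sequences of tower-type length without subsequences of
length `m + d` that are homogeneous at all levels up to `d`. -/
theorem exists_twr_length_not_leadingHomogeneous (m d : ℕ) (hd : 1 ≤ d) :
    ∃ L : ℕ, (L : ℝ) = twr d m ∧ ∃ v : Fin L → ℕ → ℝ, (∀ i, v i 0 = 1) ∧
      (∀ a b, a < b → v a 1 < v b 1) ∧ (∀ k ≤ d, LeadingGeneric k v) ∧
      ∀ s : Fin (m + d) → Fin L, StrictMono s → ¬ ∀ k ≤ d, LeadingHomogeneous k (v ∘ s) := by
  induction d, hd using Nat.le_induction with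
  | base =>
    refine ⟨m, rfl, fun i j => (i : ℝ) ^ j, fun i => pow_zero _, fun a b h => ?_,
      fun k _ s hs => leadingDet_pow_ne_zero hs, fun s hs => ?_⟩
    · simpa using h
    · have := Fintype.card_le_of_injective s hs.injective
      simp at this
  | succ d hd ih =>
    obtain ⟨L, hL, v, hv0, hv1, hg, hv⟩ := ih
    obtain ⟨w, hw0, hwg, hw⟩ := exists_stepUp v hg
    refine ⟨2 ^ L, ?_, w, hw0, fun a b hab => ?_, hwg, fun s hs hhom => ?_⟩
    · obtain ⟨e, rfl⟩ := Nat.exists_eq_add_of_le' hd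
      rw [twr, ← hL]
      simp
    -- Level 1 above has the sign of level 0 below, which is the leading coordinate `1`.
    · obtain ⟨b', hb'⟩ := exists_isTopDiff (x := a) (y := b) hab
      have h := hw 0 (Nat.zero_le _) ![a, b] (fun _ => ⟨b', hb'.lt_of_lt_two_pow b.2⟩)
        (fun i j _ => Subsingleton.elim (α := Fin 1) i j) (fun j => by
          have : j = 0 := Subsingleton.elim (α := Fin 1) _ _
          subst this
          exact hb')
      have h1 : 0 < leadingDet 1 (w ∘ ![a, b]) := by
        rw [leadingDet_zero, Function.comp_apply, hv0, mul_one] at h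
        exact h
      rw [leadingDet_one (w ∘ _) (fun j => hw0 _)] at h1
      exact sub_pos.1 h1
    · obtain ⟨u, hu, huh⟩ := exists_leadingHomogeneous_of_stepUp hd le_rfl hv0 hv1 hw hs hhom
      exact hv u hu huh

/-! ### Back to point sequences and the final bound. -/

/-- The points of `ℝ^d` with given homogeneous coordinates. -/
def affinePart (d : ℕ) {N : ℕ} (v : Fin N → ℕ → ℝ) : Fin N → Fin d → ℝ := fun i j => v i (j + 1)

theorem orientationSign_affinePart {d N : ℕ} {v : Fin N → ℕ → ℝ} (hv : ∀ i, v i 0 = 1)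
    (s : Fin (d + 1) → Fin N) :
    orientationSign (affinePart d v ∘ s) = SignType.sign (leadingDet d (v ∘ s)) := by
  unfold orientationSign leadingDet
  congr 2
  ext i j
  refine Fin.cases ?_ (fun i => ?_) i
  · simp [hv]
  · simp [affinePart]

/-- An affine dependence among `k + 1` points is a kernel vector of their leading matrix: row `0`
records the sum of the weights, and the other rows the first `k` coordinates. -/
theorem inGeneralPosition_affinePart {d N : ℕ} {v : Fin N → ℕ → ℝ} (hv : ∀ i, v i 0 = 1)
    (hg : ∀ k ≤ d, LeadingGeneric k v) : InGeneralPosition (affinePart d v) := by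
  intro T hT
  rcases T.eq_empty_or_nonempty with rfl | hne
  · have : IsEmpty (∅ : Finset (Fin N)) := Finset.isEmpty_coe_sort.2 rfl
    exact affineIndependent_of_subsingleton ℝ _
  obtain ⟨k, hk⟩ : ∃ k, T.card = k + 1 := ⟨T.card - 1, by have := hne.card_pos; omega⟩
  have hdet := hg k (by omega) (T.orderEmbOfFin hk) (T.orderEmbOfFin hk).injective
  have hinj : AffineIndependent ℝ (affinePart d v ∘ T.orderEmbOfFin hk) := by
    rw [affineIndependent_iff_of_fintype]
    intro c hc hsum
    rw [Finset.weightedVSub_eq_linear_combination _ hc] at hsum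
    have hmul : (Matrix.of fun i j : Fin (k + 1) => (v ∘ T.orderEmbOfFin hk) j i).mulVec c = 0 := by
      ext i
      simp only [Matrix.mulVec, dotProduct, Matrix.of_apply, Pi.zero_apply, Function.comp_apply]
      rcases Nat.eq_zero_or_pos i with h0 | h0
      · rw [h0, ← hc]
        exact Finset.sum_congr rfl fun j _ => by rw [hv, one_mul]
      · have := congrFun hsum ⟨(i : ℕ) - 1, by omega⟩
        simp only [Finset.sum_apply, Pi.smul_apply, Function.comp_apply, affinePart, smul_eq_mul,
          Pi.zero_apply, Nat.sub_add_cancel h0] at this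
        rw [← this]
        exact Finset.sum_congr rfl fun j _ => mul_comm _ _
    by_contra hne'
    push Not at hne'
    obtain ⟨i, hi⟩ := hne'
    exact hdet (Matrix.exists_mulVec_eq_zero_iff.1 ⟨c, fun h => hi (congrFun h i), hmul⟩)
  exact (affineIndependent_equiv (T.orderIsoOfFin hk).toEquiv).1 hinj

theorem leadingHomogeneous_of_isOrderTypeHomogeneous {d N n : ℕ} {v : Fin N → ℕ → ℝ}
    (hv : ∀ i, v i 0 = 1) (hg : LeadingGeneric d v) {s : Fin n ↪o Fin N}
    (h : IsOrderTypeHomogeneous (affinePart d v ∘ s)) : LeadingHomogeneous d (v ∘ s) := by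
  have hsign : ∀ t t' : Fin (d + 1) ↪o Fin n, SignType.sign (leadingDet d ((v ∘ s) ∘ t))
      = SignType.sign (leadingDet d ((v ∘ s) ∘ t')) := by
    intro t t'
    have := h.2 t t'
    rw [Function.comp_assoc, Function.comp_assoc, orientationSign_affinePart hv,
      orientationSign_affinePart hv] at this
    exact this
  by_cases hne : Nonempty (Fin (d + 1) ↪o Fin n)
  · obtain ⟨t₀⟩ := hne
    have h0 : leadingDet d ((v ∘ s) ∘ t₀) ≠ 0 := hg (s ∘ t₀) (s.injective.comp t₀.injective)
    refine ⟨leadingDet d ((v ∘ s) ∘ t₀), fun t ht => ?_⟩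
    have := hsign t₀ (OrderEmbedding.ofStrictMono t ht)
    rw [OrderEmbedding.coe_ofStrictMono] at this
    rw [← sign_eq_one_iff, sign_mul, this, ← sign_mul, sign_eq_one_iff]
    exact mul_self_pos.2 (hg (s ∘ t) (s.injective.comp ht.injective))
  -- With no increasing tuple the condition is vacuous and any `ε` works.
  · exact ⟨0, fun t ht => absurd ⟨OrderEmbedding.ofStrictMono t ht⟩ hne⟩

theorem orderTypeRamseySet_mono {d n N M : ℕ} (hN : N ∈ orderTypeRamseySet d n) (h : N ≤ M) :
    M ∈ orderTypeRamseySet d n := by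
  intro p hp
  obtain ⟨s, hs⟩ := hN (p ∘ Fin.castLE h) (hp.comp (Fin.castLE_injective h))
  exact ⟨s.trans (Fin.castLEOrderEmb h), hs⟩

theorem twr_mono (d : ℕ) {x y : ℝ} (h : x ≤ y) : twr d x ≤ twr d y := by
  match d with
  | 0 => exact h
  | 1 => exact h
  | k + 2 => exact Real.rpow_le_rpow_of_exponent_le one_le_two (twr_mono (k + 1) h)

theorem theorem3 (d : ℕ) (hd : 2 ≤ d) :
    (∀ n : ℕ, IsLeast (orderTypeRamseySet d n) (OT d n)) ∧
      ∃ c : ℝ, 0 < c ∧ ∃ n₀ : ℕ, ∀ n : ℕ, n₀ ≤ n → twr d (c * (n : ℝ)) ≤ (OT d n : ℝ) := by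
  have hleast : ∀ n : ℕ, IsLeast (orderTypeRamseySet d n) (OT d n) := fun n =>
    ⟨Nat.sInf_mem (orderTypeRamseySet_nonempty d n), fun N hN => Nat.sInf_le hN⟩
  refine ⟨hleast, ?_⟩
  obtain ⟨C, hC⟩ := exists_leadingHomogeneous_all d
  refine ⟨1 / (2 * (C + 1)), by positivity, 2 * (C + 1) * (d + 2), fun n hn => ?_⟩
  -- Here `C * q ≤ n` with `q = m + d + 1` allows `m + d` terms to be extracted, and `q ≥ 2 * (d +
  -- 2)` gives `q + 1 ≤ 2 * m`, so `n ≤ 2 * (C + 1) * m`. Using `C + 1` avoids division by zero.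
  let q := n / (C + 1)
  let m := q - (d + 1)
  have hq1 : (C + 1) * q ≤ n := Nat.mul_div_le n (C + 1)
  have hq2 : n < (C + 1) * (q + 1) := Nat.lt_mul_div_succ n (Nat.succ_pos C)
  have hq3 : 2 * (d + 2) ≤ q := by
    refine (Nat.le_div_iff_mul_le (Nat.succ_pos C)).2 (le_trans (le_of_eq ?_) hn)
    rw [Nat.succ_eq_add_one]
    ring
  have hmq : m + d + 1 = q := by omega
  have hcm : 1 / (2 * ((C : ℝ) + 1)) * n ≤ m := by
    rw [one_div_mul_eq_div, div_le_iff₀ (by positivity)]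
    have h1 : n ≤ m * (2 * (C + 1)) := by
      have : q + 1 ≤ 2 * m := by omega
      nlinarith [Nat.mul_le_mul_left (C + 1) this]
    exact_mod_cast h1
  obtain ⟨L, hL, v, hv0, -, hg, hv⟩ := exists_twr_length_not_leadingHomogeneous m d (by omega)
  refine (twr_mono d hcm).trans ?_
  rw [← hL, Nat.cast_le]
  by_contra! hlt
  obtain ⟨s, hs⟩ := orderTypeRamseySet_mono (hleast n).1 hlt.le (affinePart d v)
    (inGeneralPosition_affinePart hv0 hg)
  obtain ⟨t, ht, hhom⟩ := hC n (m + d) (v ∘ s) (by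
      rw [hmq]
      exact le_trans (Nat.mul_le_mul_right q (Nat.le_succ C)) hq1)
    (fun k hk => (hg k hk).comp s.injective)
    (leadingHomogeneous_of_isOrderTypeHomogeneous hv0 (hg d le_rfl) hs)
  exact hv (s ∘ t) (s.strictMono.comp ht) hhom
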